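/- For integers $n,\ell\ge 0$ let $S_n$ be the symmetric group on $n$ elements and let $$N_\ell(n)=\frac{\left|\{(\pi_1,\dots,\pi_\ell)\in S_n^\ell : \pi_j\pi_k=\pi_k\pi_j \text{ for all } 1\le j,k\le \ell\}\right|}{|S_n|}.$$ For $n\ge 1$ put $\Delta_\ell(n)=N_\ell(n)^2-N_\ell(n-1)\,N_\ell(n+1)$. The double sequence $\{N_\ell(n)\}$ is called log-concave at $n$ for $\ell$ if $\Delta_\ell(n)\ge 0$, and strictly log-convex at $n$ for $\ell$ if $\Delta_\ell(n)<0$. **Theorem.** Let $n\ge 2$ be an integer. 1. If $n\equiv 0\pmod 3$, then $\{N_\ell(n)\}$ is log-concave at $n$ for all but finitely many $\ell$. 2. If $n\equiv 1\pmod 3$, then $\{N_\ell(n)\}$ is strictly log-convex at $n$ for all but finitely many $\ell$. 3. If $n\equiv 2\pmod 3$ and $n<20$, then $\{N_\ell(n)\}$ is log-concave at $n$ for all but finitely many $\ell$; if $n\equiv 2\pmod 3$ and $n\ge 20$, then $\{N_\ell(n)\}$ is strictly log-convex at $n$ for all but finitely many $\ell$. The finite set of exceptional $\ell$ may depend on $n$.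 -/

import Mathlib

/-- The commuting `ℓ`-tuples `(π₁, …, π_ℓ)` of permutations in the symmetric group `S_n`. -/
def commutingTuples (ℓ n : ℕ) : Set (Fin ℓ → Equiv.Perm (Fin n)) :=
  {π | ∀ j k : Fin ℓ, π j * π k = π k * π j}

/-- `N_ℓ(n)`: the number of commuting `ℓ`-tuples in `S_n`, divided by `|S_n|` as a rational
number. -/
noncomputable def normalizedCount (ℓ n : ℕ) : ℚ :=
  ((commutingTuples ℓ n).ncard : ℚ) / (Nat.card (Equiv.Perm (Fin n)) : ℚ)

/-- `Δ_ℓ(n) = N_ℓ(n)² - N_ℓ(n-1) N_ℓ(n+1)`, used only for `n ≥ 1`. -/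
noncomputable def logConcavityDefect (ℓ n : ℕ) : ℚ :=
  normalizedCount ℓ n ^ 2 - normalizedCount ℓ (n - 1) * normalizedCount ℓ (n + 1)

/-- The double sequence `N_ℓ(n)` is log-concave at `n` for `ℓ`. -/
def LogConcaveAt (ℓ n : ℕ) : Prop := 0 ≤ logConcavityDefect ℓ n

/-- The double sequence `N_ℓ(n)` is strictly log-convex at `n` for `ℓ`. -/
def StrictlyLogConvexAt (ℓ n : ℕ) : Prop := logConcavityDefect ℓ n < 0

/-!
The proof determines the asymptotic behaviour of `N_ℓ(n)` as `ℓ → ∞` for fixed `n`.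

Removing the orbit of one point from a commuting tuple gives the recursion
`n N_ℓ(n) = ∑ s_ℓ(m) N_ℓ(n - m)`, where `s_ℓ(m)` is the number of transitive commuting `ℓ`-tuples in
`S_m` divided by `(m - 1)!` (`ncard_commutingTuples_succ`, `scaledCount_succ`). A transitive commuting
tuple lives in a regular abelian group, so their number is asymptotic to `r_m m ^ ℓ` with `r_m` the
number of regular abelian subgroups of `S_m` (`transitiveCount_le`, `le_transitiveCount`); here
`r_1 = r_2 = r_3 = 1` and `r_4 = 4`.

Hence `N_ℓ(n)` grows like `M(n) ^ ℓ`, where `M(n)` is the largest product of the parts of a partition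
of `n`: `3 ^ k`, `4 * 3 ^ (k - 1)`, `2 * 3 ^ k` for `n = 3k, 3k + 1, 3k + 2`. At `n = 1`, where the
largest product is `1`, the value `M(1) = 4/3` of the formula is kept; this makes the formula uniform
and only forces the leading coefficient to vanish there. The next relevant rate is always at most `8/9` of this, and feeding the ansatz
`N_ℓ(n) / M(n) ^ ℓ = c + d (8/9) ^ ℓ + o((8/9) ^ ℓ)` into the recursion yields closed forms for `c`
and `d` (`hasExpansion_scaledCount`).

For `n ≡ 0` and `n ≡ 1` modulo `3` the comparison of `M(n)²` with `M(n - 1) M(n + 1)` decides. For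
`n = 3q + 2` these agree, and the difference of the leading coefficients is a positive multiple of
`6 - q` (`leadingCoeff_defect`). It vanishes only at `n = 20`, where the coefficients of `(8/9) ^ ℓ`
decide in favour of log-convexity.
-/

open Filter Topology Asymptotics

/-! ### Commuting tuples and their orbits -/

/-- The commuting families of permutations of `α` indexed by `ι`. -/
def commutingFamilies (ι α : Type*) : Set (ι → Equiv.Perm α) :=
  {π | ∀ j k : ι, π j * π k = π k * π j}

/-- The set `P` is mapped into itself by every member of the family `π`. -/
def IsInvariantSet {ι α : Type*} (π : ι → Equiv.Perm α) (P : Set α) : Prop :=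
  ∀ j, ∀ a ∈ P, π j a ∈ P

/-- `O` is the orbit of `x` under the family `π`, encoded as the least invariant set containing `x`.
On a finite type this is the orbit under the group generated by the family. -/
def IsOrbitOf {ι α : Type*} (π : ι → Equiv.Perm α) (x : α) (O : Set α) : Prop :=
  x ∈ O ∧ IsInvariantSet π O ∧ ∀ P : Set α, x ∈ P → IsInvariantSet π P → O ⊆ P

/-- The commuting families for which the orbit of `x` is everything. -/
def transitiveFamilies (ι : Type*) {α : Type*} (x : α) : Set (ι → Equiv.Perm α) :=
  {π | π ∈ commutingFamilies ι α ∧ ∀ P : Set α, x ∈ P → IsInvariantSet π P → P = Set.univ}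

theorem exists_isOrbitOf {ι α : Type*} (π : ι → Equiv.Perm α) (x : α) :
    ∃ O, IsOrbitOf π x O := by
  refine ⟨⋂₀ {P | x ∈ P ∧ IsInvariantSet π P}, ?_, ?_, ?_⟩
  · exact fun P hP => hP.1
  · exact fun j a ha P hP => hP.2 j a (ha P hP)
  · exact fun P hx hP a ha => ha P ⟨hx, hP⟩

theorem IsOrbitOf.unique {ι α : Type*} {π : ι → Equiv.Perm α} {x : α} {O O' : Set α}
    (h : IsOrbitOf π x O) (h' : IsOrbitOf π x O') : O = O' :=
  (h.2.2 O' h'.1 h'.2.1).antisymm (h'.2.2 O h.1 h.2.1)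

theorem ncard_commutingFamilies_congr (ι : Type*) {α β : Type*} (e : α ≃ β) :
    (commutingFamilies ι α).ncard = (commutingFamilies ι β).ncard := by
  let E : (ι → Equiv.Perm α) ≃ (ι → Equiv.Perm β) := Equiv.piCongrRight fun _ => e.permCongr
  refine Set.ncard_congr (fun π _ => E π) ?_ (fun _ _ _ _ h => E.injective h) ?_
  · intro π hπ j k
    have := hπ j k
    ext b
    have h1 := Equiv.congr_fun this (e.symm b)
    simpa [E] using h1
  · intro π hπ
    refine ⟨E.symm π, ?_, by simp⟩
    intro j k
    ext a
    have h1 := Equiv.congr_fun (hπ j k) (e a)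
    simpa [E, Equiv.permCongr] using h1

theorem map_mem_transitiveFamilies {ι α β : Type*} (e : α ≃ β) (x : α)
    {π : ι → Equiv.Perm α} (hπ : π ∈ transitiveFamilies ι x) :
    (fun j => e.permCongr (π j)) ∈ transitiveFamilies ι (e x) := by
  refine ⟨?_, ?_⟩
  · intro j k
    ext b
    have h1 := Equiv.congr_fun (hπ.1 j k) (e.symm b)
    simpa using h1
  · intro P hx hP
    have h := hπ.2 (e ⁻¹' P) hx (fun j a ha => by simpa using hP j (e a) ha)
    refine Set.eq_univ_of_forall fun b => ?_
    have hb : e.symm b ∈ e ⁻¹' P := h ▸ Set.mem_univ _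
    simpa using hb

theorem ncard_transitiveFamilies_congr (ι : Type*) {α β : Type*} (e : α ≃ β) (x : α) :
    (transitiveFamilies ι x).ncard = (transitiveFamilies ι (e x)).ncard := by
  let E : (ι → Equiv.Perm α) ≃ (ι → Equiv.Perm β) := Equiv.piCongrRight fun _ => e.permCongr
  refine Set.ncard_congr (fun π _ => E π) (fun π hπ => map_mem_transitiveFamilies e x hπ)
    (fun _ _ _ _ h => E.injective h) ?_
  intro π hπ
  refine ⟨E.symm π, ?_, by simp⟩
  have := map_mem_transitiveFamilies e.symm (e x) hπ
  rw [e.symm_apply_apply] at this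
  exact this

/-- Splitting off an orbit: a commuting family with `O` as the orbit of `x` is a transitive
commuting family on `O` together with an arbitrary commuting family on the complement. -/
theorem ncard_isOrbitOf {ι α : Type*} [Finite α] (x : α) (O : Set α) (hx : x ∈ O) :
    {π ∈ commutingFamilies ι α | IsOrbitOf π x O}.ncard =
      (transitiveFamilies ι (⟨x, hx⟩ : {a // a ∈ O})).ncard *
        (commutingFamilies ι {a // a ∉ O}).ncard := by
  classical
  rw [← Set.ncard_prod]
  symm
  let Φ := Equiv.Perm.subtypeCongrHom (fun a => a ∈ O)
  have hΦ : Function.Injective Φ := Equiv.Perm.subtypeCongrHom_injective _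
  have hin : ∀ (f : Equiv.Perm {a // a ∈ O} × Equiv.Perm {a // a ∉ O}) (a : α) (ha : a ∈ O),
      Φ f a = f.1 ⟨a, ha⟩ := fun f a ha => Equiv.Perm.subtypeCongr.left_apply _ _ ha
  refine Set.ncard_congr (fun f _ j => Φ (f.1 j, f.2 j)) ?_ ?_ ?_
  · rintro ⟨ρ, τ⟩ ⟨hρ, hτ⟩
    refine ⟨?_, hx, ?_, ?_⟩
    · intro j k
      rw [← map_mul, ← map_mul, Prod.mk_mul_mk, Prod.mk_mul_mk, hρ.1 j k, hτ j k]
    · intro j a ha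
      simp only [hin _ a ha]
      exact Subtype.coe_prop _
    · intro P hxP hP a ha
      have h := hρ.2 {b | (b : α) ∈ P} hxP (fun j b hb => by
        have := hP j b hb
        simp only [hin _ _ b.2] at this
        exact this)
      have : (⟨a, ha⟩ : {a // a ∈ O}) ∈ {b : {a // a ∈ O} | (b : α) ∈ P} := h ▸ Set.mem_univ _
      exact this
  · rintro ⟨ρ, τ⟩ ⟨ρ', τ'⟩ _ _ h
    have h' : ∀ j, (ρ j, τ j) = (ρ' j, τ' j) := fun j => hΦ (congrFun h j)
    simp only [Prod.mk.injEq] at h' ⊢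
    exact ⟨funext fun j => (h' j).1, funext fun j => (h' j).2⟩
  · rintro π ⟨hπ, -, hO, hmin⟩
    have hiff : ∀ j a, π j a ∈ O ↔ a ∈ O := by
      intro j a
      refine ⟨fun h => ?_, hO j a⟩
      have himg : π j '' O = O :=
        Set.eq_of_subset_of_ncard_le (by rintro _ ⟨b, hb, rfl⟩; exact hO j b hb)
          (Set.ncard_image_of_injective O (π j).injective).ge
      rw [← himg] at h
      obtain ⟨b, hb, hba⟩ := h
      rwa [← (π j).injective hba]
    let ρ : ι → Equiv.Perm {a // a ∈ O} := fun j => (π j).subtypePerm (hiff j)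
    let τ : ι → Equiv.Perm {a // a ∉ O} := fun j =>
      (π j).subtypePerm (fun a => not_congr (hiff j a))
    have hrec : (fun j => Φ (ρ j, τ j)) = π := by
      funext j
      ext a
      by_cases ha : a ∈ O
      · rw [hin _ a ha]; rfl
      · exact Equiv.Perm.subtypeCongr.right_apply _ _ ha
    refine ⟨(ρ, τ), ⟨⟨?_, ?_⟩, ?_⟩, hrec⟩
    · intro j k
      ext a
      exact Equiv.congr_fun (hπ j k) (a : α)
    · intro P hxP hP
      refine Set.eq_univ_of_forall fun b => ?_
      have h := hmin (Subtype.val '' P) ⟨_, hxP, rfl⟩ (by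
        rintro j _ ⟨c, hc, rfl⟩
        exact ⟨ρ j c, hP j c hc, rfl⟩) b.2
      obtain ⟨c, hc, hcb⟩ := h
      rwa [← Subtype.ext hcb]
    · intro j k
      ext a
      exact Equiv.congr_fun (hπ j k) (a : α)

/-- The number of commuting `ℓ`-tuples acting transitively on a set of `i + 1` elements. -/
noncomputable def transitiveCount (ℓ i : ℕ) : ℕ :=
  (transitiveFamilies (Fin ℓ) (0 : Fin (i + 1))).ncard

theorem ncard_transitiveFamilies_eq {α : Type*} [Finite α] (ℓ i : ℕ)
    (hα : Nat.card α = i + 1) (x : α) :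
    (transitiveFamilies (Fin ℓ) x).ncard = transitiveCount ℓ i := by
  let e := Finite.equivFinOfCardEq hα
  rw [ncard_transitiveFamilies_congr _ (e.trans (Equiv.swap (e x) 0))]
  simp [transitiveCount]

/-- The recursion obtained by removing the orbit of the point `0`, which has `i + 1` elements. -/
theorem ncard_commutingTuples_succ (ℓ n : ℕ) :
    (commutingTuples ℓ (n + 1)).ncard = ∑ i ∈ Finset.range (n + 1),
      n.choose i * (transitiveCount ℓ i * (commutingTuples ℓ (n - i)).ncard) := by
  classical
  let x : Fin (n + 1) := 0
  let Q := (Finset.univ.erase x).powerset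
  have hunion : commutingTuples ℓ (n + 1) = ⋃ S ∈ (Q : Set (Finset (Fin (n + 1)))),
      {π ∈ commutingFamilies (Fin ℓ) (Fin (n + 1)) |
        IsOrbitOf π x ((insert x S : Finset _) : Set (Fin (n + 1)))} := by
    ext π
    simp only [Set.mem_iUnion, Set.mem_ofPred_eq, exists_prop]
    constructor
    · intro hπ
      obtain ⟨O, hO⟩ := exists_isOrbitOf π x
      refine ⟨O.toFinset.erase x, ?_, hπ, ?_⟩
      · simp only [Q, Finset.mem_coe, Finset.mem_powerset]
        exact Finset.erase_subset_erase _ (Finset.subset_univ _)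
      · rw [Finset.insert_erase (Set.mem_toFinset.2 hO.1), Set.coe_toFinset]
        exact hO
    · rintro ⟨S, -, hπ, -⟩
      exact hπ
  have hdisj : (Q : Set (Finset (Fin (n + 1)))).PairwiseDisjoint (fun S =>
      {π ∈ commutingFamilies (Fin ℓ) (Fin (n + 1)) |
        IsOrbitOf π x ((insert x S : Finset _) : Set (Fin (n + 1)))}) := by
    intro S hS S' hS' hne
    refine Set.disjoint_left.2 fun π h h' => hne ?_
    have heq := Finset.coe_injective (h.2.unique h'.2)
    have hxS : x ∉ S := fun h => by simpa using Finset.mem_powerset.1 hS h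
    have hxS' : x ∉ S' := fun h => by simpa using Finset.mem_powerset.1 hS' h
    rw [← Finset.erase_insert hxS, heq, Finset.erase_insert hxS']
  have hfib : ∀ S ∈ Q, {π ∈ commutingFamilies (Fin ℓ) (Fin (n + 1)) |
        IsOrbitOf π x ((insert x S : Finset _) : Set (Fin (n + 1)))}.ncard =
      transitiveCount ℓ S.card * (commutingTuples ℓ (n - S.card)).ncard := by
    intro S hS
    have hxS : x ∉ S := fun h => by simpa using Finset.mem_powerset.1 hS h
    have hx : x ∈ ((insert x S : Finset _) : Set (Fin (n + 1))) := by simp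
    rw [ncard_isOrbitOf x _ hx]
    congr 1
    · refine ncard_transitiveFamilies_eq ℓ S.card ?_ _
      have : Nat.card {a // a ∈ insert x S} = (insert x S).card := by
        rw [Nat.card_eq_fintype_card, Fintype.card_coe]
      rw [← Finset.card_insert_of_notMem hxS, ← this]
      rfl
    · have hc : Nat.card {a // a ∉ ((insert x S : Finset _) : Set (Fin (n + 1)))} =
          n - S.card := by
        have h1 : {a // a ∉ ((insert x S : Finset _) : Set (Fin (n + 1)))} =
          {a // a ∈ (insert x S)ᶜ} := by simp
        rw [h1, Nat.card_eq_fintype_card, Fintype.card_coe, Finset.card_compl,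
          Finset.card_insert_of_notMem hxS, Fintype.card_fin]
        omega
      exact ncard_commutingFamilies_congr _ (Finite.equivFinOfCardEq hc)
  rw [hunion, Q.finite_toSet.ncard_biUnion (fun _ _ => Set.toFinite _) hdisj,
    finsum_mem_coe_finset, Finset.sum_congr rfl hfib, Finset.sum_powerset_apply_card
      (fun i => transitiveCount ℓ i * (commutingTuples ℓ (n - i)).ncard)]
  simp

/-! ### Transitive commuting tuples and regular abelian groups -/

/-- The regular abelian permutation groups of `Fin (m + 1)`, encoded by the function that sends `i`
to the element mapping `0` to `i`. -/
def regularFamilies (m : ℕ) : Set (Fin (m + 1) → Equiv.Perm (Fin (m + 1))) :=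
  {f | f ∈ commutingFamilies (Fin (m + 1)) (Fin (m + 1)) ∧ ∀ i, f i 0 = i}

/-- A transitive commuting tuple generates a regular group, hence consists of elements of it. -/
theorem exists_regularFamily {ι : Type*} {m : ℕ} {π : ι → Equiv.Perm (Fin (m + 1))}
    (hπ : π ∈ transitiveFamilies ι (0 : Fin (m + 1))) :
    ∃ f ∈ regularFamilies m, ∀ j, π j = f (π j 0) := by
  let G := Subgroup.closure (Set.range π)
  have hcomm : ∀ g ∈ G, ∀ h ∈ G, g * h = h * g := by
    have hc : ∀ g ∈ Set.range π, ∀ h ∈ Set.range π, g * h = h * g := by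
      rintro _ ⟨j, rfl⟩ _ ⟨k, rfl⟩
      exact hπ.1 j k
    intro g hg h hh
    have := (Subgroup.isMulCommutative_closure hc).is_comm.comm ⟨g, hg⟩ ⟨h, hh⟩
    exact congrArg Subtype.val this
  have hmem : ∀ j, π j ∈ G := fun j => Subgroup.subset_closure ⟨j, rfl⟩
  have hex : ∀ i, ∃ g ∈ G, g 0 = i := by
    have h := hπ.2 {i | ∃ g ∈ G, g 0 = i} ⟨1, G.one_mem, rfl⟩ (by
      rintro j _ ⟨g, hg, rfl⟩
      exact ⟨π j * g, G.mul_mem (hmem j) hg, rfl⟩)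
    intro i
    have hi : i ∈ {i | ∃ g ∈ G, g 0 = i} := h ▸ Set.mem_univ i
    exact hi
  choose f hfG hf0 using hex
  refine ⟨f, ⟨fun i k => hcomm _ (hfG i) _ (hfG k), hf0⟩, fun j => ?_⟩
  -- The set where two elements of the commutative group agree is invariant.
  have h := hπ.2 {a | π j a = f (π j 0) a} (hf0 _).symm (by
    intro k a ha
    have h1 := Equiv.congr_fun (hcomm _ (hmem j) _ (hmem k)) a
    have h2 := Equiv.congr_fun (hcomm _ (hfG (π j 0)) _ (hmem k)) a
    simp only [Equiv.Perm.mul_apply, Set.mem_ofPred_eq] at h1 h2 ha ⊢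
    rw [h1, h2, ha])
  ext1 a
  have ha : a ∈ {a | π j a = f (π j 0) a} := h ▸ Set.mem_univ a
  exact ha

theorem transitiveCount_le (ℓ m : ℕ) :
    transitiveCount ℓ m ≤ (regularFamilies m).ncard * (m + 1) ^ ℓ := by
  have hsub : transitiveFamilies (Fin ℓ) (0 : Fin (m + 1)) ⊆
      (fun p : (Fin (m + 1) → Equiv.Perm (Fin (m + 1))) × (Fin ℓ → Fin (m + 1)) => p.1 ∘ p.2) ''
        (regularFamilies m ×ˢ Set.univ) := by
    intro π hπ
    obtain ⟨f, hf, h⟩ := exists_regularFamily hπ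
    exact ⟨(f, fun j => π j 0), ⟨hf, Set.mem_univ _⟩, funext fun j => (h j).symm⟩
  refine (Set.ncard_le_ncard hsub).trans ((Set.ncard_image_le).trans ?_)
  rw [Set.ncard_prod, Set.ncard_univ]
  simp

theorem pow_le_ncard_surjective (ℓ m : ℕ) :
    (m + 1) ^ ℓ ≤ {v : Fin ℓ → Fin (m + 1) | Function.Surjective v}.ncard + (m + 1) * m ^ ℓ := by
  have hcompl : {v : Fin ℓ → Fin (m + 1) | Function.Surjective v}ᶜ ⊆
      ⋃ i ∈ ((Finset.univ : Finset (Fin (m + 1))) : Set (Fin (m + 1))),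
        {v : Fin ℓ → Fin (m + 1) | ∀ j, v j ≠ i} := by
    intro v hv
    simp only [Function.Surjective, Set.mem_compl_iff, Set.mem_ofPred_eq, not_forall,
      not_exists] at hv
    simpa using hv
  have hcard : ∀ i : Fin (m + 1), {v : Fin ℓ → Fin (m + 1) | ∀ j, v j ≠ i}.ncard = m ^ ℓ := by
    intro i
    have e : {v : Fin ℓ → Fin (m + 1) // ∀ j, v j ≠ i} ≃ (Fin ℓ → {y : Fin (m + 1) // y ≠ i}) :=
      Equiv.subtypePiEquivPi (p := fun _ y => y ≠ i)
    rw [← Nat.card_coe_set_eq, Set.coe_ofPred, Nat.card_congr e]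
    simp
  have h1 := Set.ncard_add_ncard_compl {v : Fin ℓ → Fin (m + 1) | Function.Surjective v}
  have h2 := (Set.ncard_le_ncard hcompl).trans (Finset.set_ncard_biUnion_le _ _)
  simp only [hcard, Finset.sum_const, Finset.card_univ, Fintype.card_fin, smul_eq_mul] at h2
  simp only [Nat.card_eq_fintype_card, Fintype.card_pi, Fintype.card_fin, Finset.prod_const,
    Finset.card_univ] at h1
  omega

theorem le_transitiveCount (ℓ m : ℕ) :
    (regularFamilies m).ncard * (m + 1) ^ ℓ ≤
      transitiveCount ℓ m + (regularFamilies m).ncard * ((m + 1) * m ^ ℓ) := by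
  have hle : (regularFamilies m).ncard *
      {v : Fin ℓ → Fin (m + 1) | Function.Surjective v}.ncard ≤ transitiveCount ℓ m := by
    rw [← Set.ncard_prod]
    refine Set.ncard_le_ncard_of_injOn (fun p => p.1 ∘ p.2) ?_ ?_
    · rintro ⟨f, v⟩ ⟨hf, hv⟩
      refine ⟨fun j k => hf.1 _ _, fun P h0 hP => Set.eq_univ_of_forall fun i => ?_⟩
      obtain ⟨j, rfl⟩ := hv i
      have := hP j 0 h0
      simpa only [Function.comp_apply, hf.2] using this
    · rintro ⟨f, v⟩ ⟨hf, hv⟩ ⟨f', v'⟩ ⟨hf', hv'⟩ h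
      have hvv : v = v' := by
        funext j
        have := Equiv.congr_fun (congrFun h j) 0
        simpa only [Function.comp_apply, hf.2, hf'.2] using this
      subst hvv
      have hff : f = f' := by
        funext i
        obtain ⟨j, rfl⟩ := hv i
        exact congrFun h j
      rw [hff]
  calc _ ≤ (regularFamilies m).ncard * (_ + _) := Nat.mul_le_mul_left _ (pow_le_ncard_surjective ℓ m)
    _ ≤ _ := by rw [mul_add]; exact Nat.add_le_add_right hle _

/-- Since the member of a regular family that fixes `0` is the identity, only the other members have
to be enumerated. -/
theorem ncard_regularFamilies (m : ℕ) :
    (regularFamilies m).ncard = ((Fintype.piFinset fun i : Fin m =>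
      Finset.univ.filter fun σ : Equiv.Perm (Fin (m + 1)) => σ 0 = i.succ).filter fun f =>
        ∀ i k, f i * f k = f k * f i).card := by
  rw [← Set.ncard_coe_finset]
  refine Set.ncard_congr (fun f _ => fun i : Fin m => f i.succ) ?_ ?_ ?_
  · rintro f ⟨hf, h0⟩
    simp only [Finset.coe_filter, Fintype.mem_piFinset, Finset.mem_filter, Finset.mem_univ,
      true_and, Set.mem_ofPred_eq]
    exact ⟨fun i => h0 _, fun i k => hf _ _⟩
  · have hone : ∀ f ∈ regularFamilies m, f 0 = 1 := by
      rintro f ⟨hf, h0⟩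
      ext1 i
      have h := Equiv.congr_fun (hf 0 i) 0
      simpa only [Equiv.Perm.mul_apply, h0, Equiv.Perm.one_apply] using h
    intro f f' hf hf' h
    funext i
    refine Fin.cases ?_ (fun i => congrFun h i) i
    rw [hone f hf, hone f' hf']
  · intro f hf
    simp only [Finset.coe_filter, Fintype.mem_piFinset, Finset.mem_filter, Finset.mem_univ,
      true_and, Set.mem_ofPred_eq] at hf
    refine ⟨Fin.cons 1 f, ⟨fun i k => ?_, fun i => ?_⟩, by simp⟩
    · refine Fin.cases ?_ (fun i => ?_) i
      · simp
      · refine Fin.cases ?_ (fun k => ?_) k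
        · simp
        · simpa using hf.2 i k
    · refine Fin.cases ?_ (fun i => ?_) i
      · simp
      · simpa using hf.1 i

theorem ncard_regularFamilies_one : (regularFamilies 1).ncard = 1 := by
  rw [ncard_regularFamilies]; decide +kernel

theorem ncard_regularFamilies_two : (regularFamilies 2).ncard = 1 := by
  rw [ncard_regularFamilies]; decide +kernel

/-- On four points there are three regular cyclic groups and one regular Klein four-group. -/
theorem ncard_regularFamilies_three : (regularFamilies 3).ncard = 4 := by
  rw [ncard_regularFamilies]; decide +kernel

/-! ### First-order expansions in powers of `8/9` -/

/-- The sequence `f` has the expansion `f ℓ = c + d (8/9)^ℓ + o((8/9)^ℓ)`. -/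
def HasExpansion (f : ℕ → ℝ) (c d : ℝ) : Prop :=
  (fun ℓ => f ℓ - c - d * (8 / 9 : ℝ) ^ ℓ) =o[atTop] fun ℓ => (8 / 9 : ℝ) ^ ℓ

theorem pow_isLittleO_pow_eight_ninths {r : ℝ} (h0 : 0 ≤ r) (h1 : r < 8 / 9) :
    (fun ℓ : ℕ => r ^ ℓ) =o[atTop] fun ℓ : ℕ => (8 / 9 : ℝ) ^ ℓ :=
  isLittleO_pow_pow_of_lt_left h0 h1

theorem tendsto_pow_eight_ninths : Tendsto (fun ℓ : ℕ => (8 / 9 : ℝ) ^ ℓ) atTop (𝓝 0) :=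
  tendsto_pow_atTop_nhds_zero_of_lt_one (by norm_num) (by norm_num)

namespace HasExpansion

variable {f g : ℕ → ℝ} {c d c' d' : ℝ}

theorem const (c : ℝ) : HasExpansion (fun _ => c) c 0 := by
  simp [HasExpansion]

theorem of_isLittleO (h : f =o[atTop] fun ℓ => (8 / 9 : ℝ) ^ ℓ) : HasExpansion f 0 0 := by
  simpa [HasExpansion] using h

theorem eight_ninths_pow : HasExpansion (fun ℓ => (8 / 9 : ℝ) ^ ℓ) 0 1 := by
  simp [HasExpansion]

theorem add (hf : HasExpansion f c d) (hg : HasExpansion g c' d') :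
    HasExpansion (fun ℓ => f ℓ + g ℓ) (c + c') (d + d') :=
  (IsLittleO.add hf hg).congr_left fun ℓ => by ring

theorem sum {ι : Type*} (s : Finset ι) {F : ι → ℕ → ℝ} {C D : ι → ℝ}
    (h : ∀ i ∈ s, HasExpansion (F i) (C i) (D i)) :
    HasExpansion (fun ℓ => ∑ i ∈ s, F i ℓ) (∑ i ∈ s, C i) (∑ i ∈ s, D i) := by
  classical
  induction s using Finset.induction_on with
  | empty => simpa using const 0
  | insert a s ha ih =>
    simp only [Finset.sum_insert ha]
    exact (h a (Finset.mem_insert_self _ _)).add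
      (ih fun i hi => h i (Finset.mem_insert_of_mem hi))

theorem tendsto (hf : HasExpansion f c d) : Tendsto f atTop (𝓝 c) := by
  have h1 := IsLittleO.trans_tendsto hf tendsto_pow_eight_ninths
  have h2 := (h1.add (tendsto_pow_eight_ninths.const_mul d)).add_const c
  simpa using h2

theorem mul (hf : HasExpansion f c d) (hg : HasExpansion g c' d') :
    HasExpansion (fun ℓ => f ℓ * g ℓ) (c * c') (c * d' + d * c') := by
  have h1 : (fun ℓ => (f ℓ - c - d * (8 / 9 : ℝ) ^ ℓ) * g ℓ) =o[atTop]
      fun ℓ => (8 / 9 : ℝ) ^ ℓ := by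
    simpa using IsLittleO.mul_isBigO hf (hg.tendsto.isBigO_one ℝ)
  have h2 : (fun ℓ => c * (g ℓ - c' - d' * (8 / 9 : ℝ) ^ ℓ)) =o[atTop]
      fun ℓ => (8 / 9 : ℝ) ^ ℓ := IsLittleO.const_mul_left hg c
  have h3 : (fun ℓ => d * (8 / 9 : ℝ) ^ ℓ * (g ℓ - c')) =o[atTop] fun ℓ => (8 / 9 : ℝ) ^ ℓ := by
    have h4 : (fun ℓ => g ℓ - c') =o[atTop] fun _ => (1 : ℝ) := by
      rw [isLittleO_one_iff]
      simpa using hg.tendsto.sub_const c'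
    simpa using ((isBigO_refl (fun ℓ => (8 / 9 : ℝ) ^ ℓ) atTop).const_mul_left d).mul_isLittleO h4
  exact ((h1.add h2).add h3).congr_left fun ℓ => by ring

theorem const_mul (hf : HasExpansion f c d) (k : ℝ) :
    HasExpansion (fun ℓ => k * f ℓ) (k * c) (k * d) := by
  simpa using (const k).mul hf

theorem congr (hf : HasExpansion f c d) (h : ∀ ℓ, f ℓ = g ℓ) (hc : c = c') (hd : d = d') :
    HasExpansion g c' d' := by
  obtain rfl : f = g := funext h
  rwa [← hc, ← hd]

/-- When the constant term vanishes, the sign is eventually that of the second coefficient. -/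
theorem eventually_neg (hf : HasExpansion f 0 d) (hd : d < 0) : ∀ᶠ ℓ in atTop, f ℓ < 0 := by
  have hpos : 0 < -d / 2 := by linarith
  filter_upwards [IsLittleO.bound hf hpos] with ℓ h
  have h8 : (0 : ℝ) < (8 / 9) ^ ℓ := by positivity
  rw [Real.norm_of_nonneg h8.le, Real.norm_eq_abs] at h
  have h' := (abs_le.1 h).2
  nlinarith

end HasExpansion

/-! ### The exponential growth rate -/

/-- The exponential growth rate in `ℓ` of the number of commuting `ℓ`-tuples in `S_n`, that is, the
largest order of an abelian subgroup. At `n = 1` the value is `4/3` instead of `1`, so that tripling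
holds for all `n`; the leading coefficient at `n = 1` is then `0`. -/
noncomputable def growthRate : ℕ → ℝ
  | 0 => 1
  | 1 => 4 / 3
  | 2 => 2
  | n + 3 => 3 * growthRate n

theorem growthRate_add_three (n : ℕ) : growthRate (n + 3) = 3 * growthRate n := by
  rw [growthRate]

theorem growthRate_three_mul (k : ℕ) : growthRate (3 * k) = 3 ^ k := by
  induction k with
  | zero => simp [growthRate]
  | succ k ih => rw [mul_add, mul_one, growthRate_add_three, ih]; ring

theorem growthRate_three_mul_add_one (k : ℕ) : growthRate (3 * k + 1) = 4 / 3 * 3 ^ k := by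
  induction k with
  | zero => simp [growthRate]
  | succ k ih =>
    rw [show 3 * (k + 1) + 1 = 3 * k + 1 + 3 by ring, growthRate_add_three, ih]; ring

theorem growthRate_three_mul_add_two (k : ℕ) : growthRate (3 * k + 2) = 2 * 3 ^ k := by
  induction k with
  | zero => simp [growthRate]
  | succ k ih =>
    rw [show 3 * (k + 1) + 2 = 3 * k + 2 + 3 by ring, growthRate_add_three, ih]; ring

theorem growthRate_pos : ∀ n, 0 < growthRate n
  | 0 => by norm_num [growthRate]
  | 1 => by norm_num [growthRate]
  | 2 => by norm_num [growthRate]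
  | n + 3 => by rw [growthRate_add_three]; linarith [growthRate_pos n]

theorem exists_eq_three_mul_add (n : ℕ) : ∃ k, n = 3 * k ∨ n = 3 * k + 1 ∨ n = 3 * k + 2 :=
  ⟨n / 3, by omega⟩

/-- On `k + i + 1` points, the growth rate of the tuples for which a given orbit has `i + 1` elements,
relative to the growth rate of all tuples. -/
noncomputable def growthRatio (i k : ℕ) : ℝ := (i + 1) * growthRate k / growthRate (k + i + 1)

theorem growthRatio_nonneg (i k : ℕ) : 0 ≤ growthRatio i k :=
  div_nonneg (mul_nonneg (by positivity) (growthRate_pos _).le) (growthRate_pos _).le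

theorem growthRatio_zero_lt (k : ℕ) : growthRatio 0 k < 8 / 9 := by
  have h3 : ∀ q : ℕ, (0 : ℝ) < 3 ^ q := fun q => by positivity
  rw [growthRatio, div_lt_iff₀ (growthRate_pos _)]
  obtain ⟨q, rfl | rfl | rfl⟩ := exists_eq_three_mul_add k
  · rw [add_zero, growthRate_three_mul, growthRate_three_mul_add_one]
    push_cast; linarith [h3 q]
  · rw [add_zero, growthRate_three_mul_add_one, growthRate_three_mul_add_two]
    push_cast; linarith [h3 q]
  · rw [add_zero, add_assoc, growthRate_add_three, growthRate_three_mul_add_two,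
      growthRate_three_mul]
    push_cast; linarith [h3 q]

/-- Orbits with at least five elements are negligible to the order `(8/9) ^ ℓ`: replacing `m ≥ 5` by
`3 * (m - 3)` increases the product of the parts by a factor of at least `6/5`. -/
theorem growthRatio_le_of_four_le {i : ℕ} (hi : 4 ≤ i) (k : ℕ) : growthRatio i k ≤ 5 / 6 := by
  rw [growthRatio, div_le_iff₀ (growthRate_pos _)]
  have key : ∀ j k : ℕ, 6 * ((j : ℝ) + 5) * growthRate k ≤ 5 * growthRate (k + j + 5) ∧
      ((j : ℝ) + 2) * growthRate k ≤ growthRate (k + j + 2) := by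
    have h3 : ∀ q : ℕ, (0 : ℝ) < 3 ^ q := fun q => by positivity
    have h2 : ∀ j k : ℕ, ((j : ℝ) + 2) * growthRate k ≤ growthRate (k + j + 2) := by
      intro j
      induction j using Nat.strong_induction_on with
      | _ j ih =>
        intro k
        match j, ih with
        | 0, _ =>
          obtain ⟨q, rfl | rfl | rfl⟩ := exists_eq_three_mul_add k
          · rw [add_zero, growthRate_three_mul, growthRate_three_mul_add_two]
            push_cast; linarith [h3 q]
          · rw [add_zero, growthRate_three_mul_add_one, add_assoc, growthRate_add_three,
              growthRate_three_mul]
            push_cast; linarith [h3 q]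
          · rw [add_zero, growthRate_three_mul_add_two,
              show 3 * q + 2 + 2 = 3 * q + 1 + 3 by ring, growthRate_add_three,
              growthRate_three_mul_add_one]
            push_cast; linarith [h3 q]
        | 1, _ =>
          rw [show k + 1 + 2 = k + 3 by ring, growthRate_add_three]
          push_cast; linarith
        | 2, _ =>
          rw [show k + 2 + 2 = k + 1 + 3 by ring, growthRate_add_three]
          obtain ⟨q, rfl | rfl | rfl⟩ := exists_eq_three_mul_add k
          · rw [growthRate_three_mul, growthRate_three_mul_add_one]
            push_cast; linarith [h3 q]
          · rw [growthRate_three_mul_add_one, growthRate_three_mul_add_two]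
            push_cast; linarith [h3 q]
          · rw [growthRate_three_mul_add_two, add_assoc, growthRate_add_three,
              growthRate_three_mul]
            push_cast; linarith [h3 q]
        | j + 3, ih =>
          have h := ih j (by omega) k
          rw [show k + (j + 3) + 2 = k + j + 2 + 3 by ring, growthRate_add_three]
          have hk := growthRate_pos k
          have hj : (0 : ℝ) ≤ j := j.cast_nonneg
          push_cast
          nlinarith
    refine fun j k => ⟨?_, h2 j k⟩
    rw [show k + j + 5 = k + j + 2 + 3 by ring, growthRate_add_three]
    have hk := growthRate_pos k
    have hj : (0 : ℝ) ≤ j := j.cast_nonneg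
    nlinarith [h2 j k]
  obtain ⟨j, rfl⟩ := Nat.exists_eq_add_of_le hi
  have := (key j k).1
  rw [show k + j + 5 = k + (4 + j) + 1 by ring] at this
  push_cast
  linarith

theorem growthRatio_one_three_mul (q : ℕ) : growthRatio 1 (3 * q) = 1 := by
  rw [growthRatio, add_assoc, growthRate_three_mul, growthRate_three_mul_add_two]
  field_simp; norm_num

theorem growthRatio_one_three_mul_add_one (q : ℕ) : growthRatio 1 (3 * q + 1) = 8 / 9 := by
  rw [growthRatio, growthRate_three_mul_add_one, show 3 * q + 1 + 1 + 1 = 3 * q + 3 by ring,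
    growthRate_add_three, growthRate_three_mul]
  field_simp; norm_num

theorem growthRatio_one_three_mul_add_two (q : ℕ) : growthRatio 1 (3 * q + 2) = 1 := by
  rw [growthRatio, growthRate_three_mul_add_two, show 3 * q + 2 + 1 + 1 = 3 * q + 1 + 3 by ring,
    growthRate_add_three, growthRate_three_mul_add_one]
  field_simp; norm_num

theorem growthRatio_two (k : ℕ) : growthRatio 2 k = 1 := by
  have := growthRate_pos k
  rw [growthRatio, add_assoc, growthRate_add_three]
  field_simp; norm_num

theorem growthRatio_three_three_mul (q : ℕ) : growthRatio 3 (3 * q) = 1 := by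
  rw [growthRatio, show 3 * q + 3 + 1 = 3 * q + 1 + 3 by ring, growthRate_add_three,
    growthRate_three_mul, growthRate_three_mul_add_one]
  field_simp; norm_num

theorem growthRatio_three_three_mul_add_one (q : ℕ) : growthRatio 3 (3 * q + 1) = 8 / 9 := by
  rw [growthRatio, show 3 * q + 1 + 3 + 1 = 3 * q + 2 + 3 by ring, growthRate_add_three,
    growthRate_three_mul_add_one, growthRate_three_mul_add_two]
  field_simp; norm_num

theorem growthRatio_three_three_mul_add_two (q : ℕ) : growthRatio 3 (3 * q + 2) = 8 / 9 := by
  rw [growthRatio, show 3 * q + 2 + 3 + 1 = 3 * q + 3 + 3 by ring, growthRate_add_three,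
    growthRate_add_three, growthRate_three_mul, growthRate_three_mul_add_two]
  field_simp; norm_num

/-! ### Expansion of the weight of one orbit -/

/-- The number of transitive commuting tuples on `i + 1` points, scaled by `i!` and by the growth
rate `(i + 1) ^ ℓ`. -/
noncomputable def orbitWeight (i ℓ : ℕ) : ℝ :=
  (transitiveCount ℓ i : ℝ) / (i.factorial : ℝ) / ((i : ℝ) + 1) ^ ℓ

/-- The limit of `orbitWeight i`, where regular abelian groups of degree `i + 1` are counted. -/
noncomputable def limitWeight (i : ℕ) : ℝ := ((regularFamilies i).ncard : ℝ) / i.factorial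

theorem abs_orbitWeight_sub_le (i ℓ : ℕ) :
    |orbitWeight i ℓ - limitWeight i| ≤ limitWeight i * (i + 1) * ((i : ℝ) / (i + 1)) ^ ℓ := by
  have hf : (0 : ℝ) < i.factorial := by positivity
  have hp : (0 : ℝ) < ((i : ℝ) + 1) ^ ℓ := by positivity
  have h1 : (transitiveCount ℓ i : ℝ) ≤ (regularFamilies i).ncard * ((i : ℝ) + 1) ^ ℓ := by
    exact_mod_cast transitiveCount_le ℓ i
  have h2 : ((regularFamilies i).ncard : ℝ) * ((i : ℝ) + 1) ^ ℓ ≤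
      transitiveCount ℓ i + (regularFamilies i).ncard * (((i : ℝ) + 1) * (i : ℝ) ^ ℓ) := by
    exact_mod_cast le_transitiveCount ℓ i
  have e1 : orbitWeight i ℓ - limitWeight i = ((transitiveCount ℓ i : ℝ) -
      (regularFamilies i).ncard * ((i : ℝ) + 1) ^ ℓ) / (i.factorial * ((i : ℝ) + 1) ^ ℓ) := by
    rw [orbitWeight, limitWeight]; field_simp
  have e2 : limitWeight i * (i + 1) * ((i : ℝ) / (i + 1)) ^ ℓ =
      ((regularFamilies i).ncard * (((i : ℝ) + 1) * (i : ℝ) ^ ℓ)) /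
        (i.factorial * ((i : ℝ) + 1) ^ ℓ) := by
    rw [limitWeight, div_pow]; field_simp
  rw [e1, e2, abs_div, abs_of_pos (mul_pos hf hp)]
  gcongr
  rw [abs_le]
  constructor <;> linarith

theorem orbitWeight_sub_isBigO (i : ℕ) :
    (fun ℓ => orbitWeight i ℓ - limitWeight i) =O[atTop] fun ℓ => ((i : ℝ) / (i + 1)) ^ ℓ := by
  refine IsBigO.of_bound (limitWeight i * (i + 1)) (Eventually.of_forall fun ℓ => ?_)
  rw [Real.norm_eq_abs, Real.norm_of_nonneg (by positivity)]
  exact abs_orbitWeight_sub_le i ℓ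

theorem orbitWeight_isBigO_one (i : ℕ) : (fun ℓ => orbitWeight i ℓ) =O[atTop] fun _ => (1 : ℝ) := by
  have h1 : (fun ℓ : ℕ => ((i : ℝ) / (i + 1)) ^ ℓ) =O[atTop] fun _ => (1 : ℝ) := by
    refine IsBigO.of_bound 1 (Eventually.of_forall fun ℓ => ?_)
    rw [Real.norm_of_nonneg (by positivity)]
    simp only [norm_one, mul_one]
    refine pow_le_one₀ (by positivity) ?_
    rw [div_le_one (by positivity)]
    linarith
  have h2 := ((orbitWeight_sub_isBigO i).trans h1).add
    (isBigO_const_const (limitWeight i) (one_ne_zero (α := ℝ)) atTop)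
  simpa using h2

theorem hasExpansion_orbitWeight {i : ℕ} (hi : i < 4) :
    HasExpansion (orbitWeight i) (limitWeight i) 0 := by
  have hlt : (i : ℝ) / (i + 1) < 8 / 9 := by
    rw [div_lt_iff₀ (by positivity)]
    have : (i : ℝ) ≤ 3 := by exact_mod_cast Nat.le_of_lt_succ hi
    linarith
  simpa [HasExpansion] using (orbitWeight_sub_isBigO i).trans_isLittleO
    (pow_isLittleO_pow_eight_ninths (by positivity) hlt)

theorem limitWeight_one : limitWeight 1 = 1 := by
  simp [limitWeight, ncard_regularFamilies_one]

theorem limitWeight_two : limitWeight 2 = 1 / 2 := by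
  simp [limitWeight, ncard_regularFamilies_two]

theorem limitWeight_three : limitWeight 3 = 2 / 3 := by
  norm_num [limitWeight, ncard_regularFamilies_three, Nat.factorial]

/-- The coefficients of `1` in the expansion of `orbitWeight i ℓ * growthRatio i k ^ ℓ`. -/
noncomputable def leadingWeight (i k : ℕ) : ℝ :=
  match i, k % 3 with
  | 1, 0 => 1
  | 1, 2 => 1
  | 2, _ => 1 / 2
  | 3, 0 => 2 / 3
  | _, _ => 0

/-- The coefficients of `(8/9) ^ ℓ` in the expansion of `orbitWeight i ℓ * growthRatio i k ^ ℓ`. -/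
noncomputable def secondWeight (i k : ℕ) : ℝ :=
  match i, k % 3 with
  | 1, 1 => 1
  | 3, 1 => 2 / 3
  | 3, 2 => 2 / 3
  | _, _ => 0

theorem hasExpansion_orbitWeight_mul (i k : ℕ) :
    HasExpansion (fun ℓ => orbitWeight i ℓ * growthRatio i k ^ ℓ)
      (leadingWeight i k) (secondWeight i k) := by
  have hsmall : ∀ i k, growthRatio i k < 8 / 9 →
      HasExpansion (fun ℓ => orbitWeight i ℓ * growthRatio i k ^ ℓ) 0 0 := fun i k h =>
    HasExpansion.of_isLittleO (by
      simpa using (orbitWeight_isBigO_one i).mul_isLittleO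
        (pow_isLittleO_pow_eight_ninths (growthRatio_nonneg i k) h))
  have hone : ∀ i k, i < 4 → growthRatio i k = 1 →
      HasExpansion (fun ℓ => orbitWeight i ℓ * growthRatio i k ^ ℓ) (limitWeight i) 0 :=
    fun i k hi h => by simpa [h] using hasExpansion_orbitWeight hi
  have hsecond : ∀ i k, i < 4 → growthRatio i k = 8 / 9 →
      HasExpansion (fun ℓ => orbitWeight i ℓ * growthRatio i k ^ ℓ) 0 (limitWeight i) :=
    fun i k hi h => by
      simpa [h] using (hasExpansion_orbitWeight hi).mul HasExpansion.eight_ninths_pow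
  have hmod : ∀ q : ℕ, (3 * q) % 3 = 0 ∧ (3 * q + 1) % 3 = 1 ∧ (3 * q + 2) % 3 = 2 :=
    fun q => by omega
  match i with
  | 0 =>
    exact (hsmall 0 k (growthRatio_zero_lt k)).congr (fun _ => rfl)
      (by simp [leadingWeight]) (by simp [secondWeight])
  | 1 =>
    obtain ⟨q, rfl | rfl | rfl⟩ := exists_eq_three_mul_add k
    · exact (hone 1 _ (by norm_num) (growthRatio_one_three_mul q)).congr (fun _ => rfl)
        (by simp [leadingWeight, limitWeight_one, hmod]) (by simp [secondWeight, hmod])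
    · exact (hsecond 1 _ (by norm_num) (growthRatio_one_three_mul_add_one q)).congr (fun _ => rfl)
        (by simp [leadingWeight, hmod]) (by simp [secondWeight, limitWeight_one, hmod])
    · exact (hone 1 _ (by norm_num) (growthRatio_one_three_mul_add_two q)).congr (fun _ => rfl)
        (by simp [leadingWeight, limitWeight_one, hmod]) (by simp [secondWeight, hmod])
  | 2 =>
    exact (hone 2 k (by norm_num) (growthRatio_two k)).congr (fun _ => rfl)
      (by simp [leadingWeight, limitWeight_two]) (by simp [secondWeight])
  | 3 =>
    obtain ⟨q, rfl | rfl | rfl⟩ := exists_eq_three_mul_add k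
    · exact (hone 3 _ (by norm_num) (growthRatio_three_three_mul q)).congr (fun _ => rfl)
        (by simp [leadingWeight, limitWeight_three, hmod]) (by simp [secondWeight, hmod])
    · exact (hsecond 3 _ (by norm_num) (growthRatio_three_three_mul_add_one q)).congr
        (fun _ => rfl) (by simp [leadingWeight, hmod])
        (by simp [secondWeight, limitWeight_three, hmod])
    · exact (hsecond 3 _ (by norm_num) (growthRatio_three_three_mul_add_two q)).congr
        (fun _ => rfl) (by simp [leadingWeight, hmod])
        (by simp [secondWeight, limitWeight_three, hmod])
  | i + 4 =>
    exact (hsmall (i + 4) k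
      ((growthRatio_le_of_four_le (by omega) k).trans_lt (by norm_num))).congr (fun _ => rfl)
      (by simp [leadingWeight]) (by simp [secondWeight])

/-! ### Expansion of the normalized counts -/

/-- The normalized count divided by its growth rate. -/
noncomputable def scaledCount (n ℓ : ℕ) : ℝ := (normalizedCount ℓ n : ℝ) / growthRate n ^ ℓ

theorem normalizedCount_eq (ℓ n : ℕ) :
    (normalizedCount ℓ n : ℝ) = ((commutingTuples ℓ n).ncard : ℝ) / (n.factorial : ℝ) := by
  simp [normalizedCount, Fintype.card_perm]

theorem scaledCount_zero (ℓ : ℕ) : scaledCount 0 ℓ = 1 := by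
  have h : (commutingTuples ℓ 0).ncard = 1 := by
    have : commutingTuples ℓ 0 = Set.univ :=
      Set.eq_univ_of_forall fun π j k => Subsingleton.elim _ _
    rw [this, Set.ncard_univ]
    simp
  simp [scaledCount, normalizedCount_eq, h, growthRate]

theorem scaledCount_succ (n ℓ : ℕ) :
    scaledCount (n + 1) ℓ = 1 / ((n : ℝ) + 1) * ∑ i ∈ Finset.range (n + 1),
      orbitWeight i ℓ * growthRatio i (n - i) ^ ℓ * scaledCount (n - i) ℓ := by
  rw [scaledCount, normalizedCount_eq, ncard_commutingTuples_succ, Nat.cast_sum, Finset.sum_div,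
    Finset.sum_div, Finset.mul_sum]
  refine Finset.sum_congr rfl fun i hi => ?_
  have hin : i ≤ n := Nat.le_of_lt_succ (Finset.mem_range.1 hi)
  have h1 : n - i + i + 1 = n + 1 := by omega
  rw [scaledCount, normalizedCount_eq, orbitWeight, growthRatio, h1, Nat.cast_mul,
    Nat.cast_choose ℝ hin, Nat.factorial_succ, div_pow, mul_pow]
  have := (growthRate_pos (n - i)).ne'
  have := (growthRate_pos (n + 1)).ne'
  have : (n.factorial : ℝ) ≠ 0 := by positivity
  have : ((n - i).factorial : ℝ) ≠ 0 := by positivity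
  have : (i.factorial : ℝ) ≠ 0 := by positivity
  push_cast
  field_simp

/-- The reciprocal of the order of the stabilizer of a partition into `q` blocks of size three. -/
noncomputable def tripleWeight (q : ℕ) : ℝ := 1 / (6 ^ q * q.factorial)

theorem tripleWeight_eq (q : ℕ) : tripleWeight q = 6 * ((q : ℝ) + 1) * tripleWeight (q + 1) := by
  rw [tripleWeight, tripleWeight, Nat.factorial_succ]
  push_cast
  field_simp
  ring

theorem tripleWeight_pos (q : ℕ) : 0 < tripleWeight q := by
  rw [tripleWeight]; positivity

/-- The limit of `scaledCount n`, to which the partitions of `n` with product of parts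
`growthRate n` contribute. -/
noncomputable def leadingCoeff (n : ℕ) : ℝ :=
  match n % 3 with
  | 0 => tripleWeight (n / 3)
  | 1 => 7 / 4 * (n / 3 : ℕ) * tripleWeight (n / 3)
  | _ => 1 / 2 * tripleWeight (n / 3)

/-- The coefficient of `(8/9) ^ ℓ` in `scaledCount n`, to which the partitions of `n` with
product of parts `8/9 * growthRate n` contribute. -/
noncomputable def secondCoeff (n : ℕ) : ℝ :=
  match n % 3 with
  | 0 => 15 / 4 * ((n / 3 : ℕ) * ((n / 3 : ℕ) - 1)) * tripleWeight (n / 3)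
  | 1 => 369 / 160 * ((n / 3 : ℕ) * ((n / 3 : ℕ) - 1) * ((n / 3 : ℕ) - 2)) * tripleWeight (n / 3)
  | _ => 43 / 32 * ((n / 3 : ℕ) * ((n / 3 : ℕ) - 1)) * tripleWeight (n / 3)

theorem mod_div_three (q : ℕ) :
    ((3 * q) % 3 = 0 ∧ (3 * q + 1) % 3 = 1 ∧ (3 * q + 2) % 3 = 2) ∧
      (3 * q) / 3 = q ∧ (3 * q + 1) / 3 = q ∧ (3 * q + 2) / 3 = q := by
  omega

theorem leadingCoeff_three_mul (q : ℕ) : leadingCoeff (3 * q) = tripleWeight q := by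
  simp only [leadingCoeff, mod_div_three]

theorem leadingCoeff_three_mul_add_one (q : ℕ) :
    leadingCoeff (3 * q + 1) = 7 / 4 * q * tripleWeight q := by
  simp only [leadingCoeff, mod_div_three]

theorem leadingCoeff_three_mul_add_two (q : ℕ) :
    leadingCoeff (3 * q + 2) = 1 / 2 * tripleWeight q := by
  simp only [leadingCoeff, mod_div_three]

theorem secondCoeff_three_mul (q : ℕ) :
    secondCoeff (3 * q) = 15 / 4 * (q * (q - 1)) * tripleWeight q := by
  simp only [secondCoeff, mod_div_three]

theorem secondCoeff_three_mul_add_one (q : ℕ) :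
    secondCoeff (3 * q + 1) = 369 / 160 * (q * (q - 1) * (q - 2)) * tripleWeight q := by
  simp only [secondCoeff, mod_div_three]

theorem secondCoeff_three_mul_add_two (q : ℕ) :
    secondCoeff (3 * q + 2) = 43 / 32 * (q * (q - 1)) * tripleWeight q := by
  simp only [secondCoeff, mod_div_three]

theorem sum_range_add_four_of_zero {F : ℕ → ℝ} (hF : ∀ i, F (i + 4) = 0) (j : ℕ) :
    ∑ i ∈ Finset.range (j + 4), F i = F 0 + F 1 + F 2 + F 3 := by
  rw [add_comm j 4, Finset.sum_range_add]
  simp [Finset.sum_range_succ, fun x => (add_comm 4 x ▸ hF x : F (4 + x) = 0)]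

theorem leadingCoeff_zero : leadingCoeff 0 = 1 := by simp [leadingCoeff, tripleWeight]
theorem leadingCoeff_one : leadingCoeff 1 = 0 := by simp [leadingCoeff]
theorem leadingCoeff_two : leadingCoeff 2 = 1 / 2 := by simp [leadingCoeff, tripleWeight]
theorem leadingCoeff_three : leadingCoeff 3 = 1 / 6 := by simp [leadingCoeff, tripleWeight]
theorem secondCoeff_zero : secondCoeff 0 = 0 := by simp [secondCoeff]
theorem secondCoeff_one : secondCoeff 1 = 0 := by simp [secondCoeff]
theorem secondCoeff_two : secondCoeff 2 = 0 := by simp [secondCoeff]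
theorem secondCoeff_three : secondCoeff 3 = 0 := by simp [secondCoeff]

/-- The leading coefficients satisfy the leading part of the orbit recursion. -/
theorem leadingCoeff_succ (n : ℕ) :
    1 / ((n : ℝ) + 1) * ∑ i ∈ Finset.range (n + 1), leadingWeight i (n - i) * leadingCoeff (n - i) =
      leadingCoeff (n + 1) := by
  have hn : (n : ℝ) + 1 ≠ 0 := by positivity
  match n with
  | 0 => simp [leadingWeight, leadingCoeff_one]
  | 1 => norm_num [Finset.sum_range_succ, leadingWeight, leadingCoeff_zero, leadingCoeff_two]
  | 2 =>
    norm_num [Finset.sum_range_succ, leadingWeight, leadingCoeff_zero, leadingCoeff_one,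
      leadingCoeff_three]
  | j + 3 =>
    rw [show j + 3 + 1 = j + 4 by ring,
      sum_range_add_four_of_zero (fun i => by simp [leadingWeight]),
      one_div, inv_mul_eq_iff_eq_mul₀ hn]
    simp only [Nat.sub_zero, show j + 3 - 1 = j + 2 by omega, show j + 3 - 2 = j + 1 by omega,
      Nat.add_sub_cancel]
    obtain ⟨q, rfl | rfl | rfl⟩ := exists_eq_three_mul_add j
    · simp only [leadingWeight, mod_div_three, show 3 * q + 4 = 3 * (q + 1) + 1 by ring,
        leadingCoeff_three_mul, leadingCoeff_three_mul_add_one, leadingCoeff_three_mul_add_two]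
      rw [tripleWeight_eq q]
      push_cast
      ring
    · simp only [leadingWeight, mod_div_three, show 3 * q + 1 + 4 = 3 * (q + 1) + 2 by ring,
        show 3 * q + 1 + 2 = 3 * (q + 1) by ring, show 3 * q + 1 + 1 = 3 * q + 2 by ring,
        leadingCoeff_three_mul, leadingCoeff_three_mul_add_one, leadingCoeff_three_mul_add_two]
      rw [tripleWeight_eq q]
      push_cast
      ring
    · simp only [leadingWeight, mod_div_three, show 3 * q + 2 + 4 = 3 * (q + 2) by ring,
        show 3 * q + 2 + 2 = 3 * (q + 1) + 1 by ring, show 3 * q + 2 + 1 = 3 * (q + 1) by ring,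
        leadingCoeff_three_mul, leadingCoeff_three_mul_add_one, leadingCoeff_three_mul_add_two]
      rw [tripleWeight_eq q, tripleWeight_eq (q + 1)]
      push_cast
      ring

/-- The coefficients satisfy the part of the orbit recursion of order `(8/9) ^ ℓ`. -/
theorem secondCoeff_succ (n : ℕ) :
    1 / ((n : ℝ) + 1) * ∑ i ∈ Finset.range (n + 1),
        (leadingWeight i (n - i) * secondCoeff (n - i) +
          secondWeight i (n - i) * leadingCoeff (n - i)) =
      secondCoeff (n + 1) := by
  have hn : (n : ℝ) + 1 ≠ 0 := by positivity
  match n with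
  | 0 => simp [leadingWeight, secondWeight, secondCoeff_one]
  | 1 =>
    norm_num [Finset.sum_range_succ, leadingWeight, secondWeight, secondCoeff_zero,
      secondCoeff_two]
  | 2 =>
    norm_num [Finset.sum_range_succ, leadingWeight, secondWeight, leadingCoeff_one,
      secondCoeff_zero, secondCoeff_one, secondCoeff_three]
  | j + 3 =>
    rw [show j + 3 + 1 = j + 4 by ring,
      sum_range_add_four_of_zero (fun i => by simp [leadingWeight, secondWeight]),
      one_div, inv_mul_eq_iff_eq_mul₀ hn]
    simp only [Nat.sub_zero, show j + 3 - 1 = j + 2 by omega, show j + 3 - 2 = j + 1 by omega,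
      Nat.add_sub_cancel]
    obtain ⟨q, rfl | rfl | rfl⟩ := exists_eq_three_mul_add j
    · simp only [leadingWeight, secondWeight, mod_div_three,
        show 3 * q + 4 = 3 * (q + 1) + 1 by ring,
        leadingCoeff_three_mul, leadingCoeff_three_mul_add_one, leadingCoeff_three_mul_add_two,
        secondCoeff_three_mul, secondCoeff_three_mul_add_one, secondCoeff_three_mul_add_two]
      rw [tripleWeight_eq q]
      push_cast
      ring
    · simp only [leadingWeight, secondWeight, mod_div_three,
        show 3 * q + 1 + 4 = 3 * (q + 1) + 2 by ring,
        show 3 * q + 1 + 2 = 3 * (q + 1) by ring, show 3 * q + 1 + 1 = 3 * q + 2 by ring,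
        leadingCoeff_three_mul, leadingCoeff_three_mul_add_one, leadingCoeff_three_mul_add_two,
        secondCoeff_three_mul, secondCoeff_three_mul_add_one, secondCoeff_three_mul_add_two]
      rw [tripleWeight_eq q]
      push_cast
      ring
    · simp only [leadingWeight, secondWeight, mod_div_three,
        show 3 * q + 2 + 4 = 3 * (q + 2) by ring,
        show 3 * q + 2 + 2 = 3 * (q + 1) + 1 by ring, show 3 * q + 2 + 1 = 3 * (q + 1) by ring,
        leadingCoeff_three_mul, leadingCoeff_three_mul_add_one, leadingCoeff_three_mul_add_two,
        secondCoeff_three_mul, secondCoeff_three_mul_add_one, secondCoeff_three_mul_add_two]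
      rw [tripleWeight_eq q, tripleWeight_eq (q + 1)]
      push_cast
      ring

theorem hasExpansion_scaledCount (n : ℕ) :
    HasExpansion (scaledCount n) (leadingCoeff n) (secondCoeff n) := by
  induction n using Nat.strong_induction_on with
  | _ n ih =>
    match n, ih with
    | 0, _ =>
      exact (HasExpansion.const 1).congr (fun ℓ => (scaledCount_zero ℓ).symm)
        leadingCoeff_zero.symm secondCoeff_zero.symm
    | n + 1, ih =>
      exact ((HasExpansion.sum (Finset.range (n + 1)) fun i _ =>
        (hasExpansion_orbitWeight_mul i (n - i)).mul (ih (n - i) (by omega))).const_mul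
          (1 / ((n : ℝ) + 1))).congr (fun ℓ => (scaledCount_succ n ℓ).symm)
          (leadingCoeff_succ n) (secondCoeff_succ n)

/-! ### Sign of the defect -/

theorem defect_eq (n ℓ : ℕ) : (logConcavityDefect ℓ (n + 1) : ℝ) =
    (growthRate (n + 1) ^ 2) ^ ℓ * scaledCount (n + 1) ℓ ^ 2 -
      (growthRate n * growthRate (n + 2)) ^ ℓ * (scaledCount n ℓ * scaledCount (n + 2) ℓ) := by
  have h0 := (growthRate_pos n).ne'
  have h1 := (growthRate_pos (n + 1)).ne'
  have h2 := (growthRate_pos (n + 2)).ne'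
  rw [logConcavityDefect, Nat.add_sub_cancel, show n + 1 + 1 = n + 2 by ring]
  push_cast
  rw [scaledCount, scaledCount, scaledCount]
  field_simp
  ring

/-- The defect is eventually positive when its scaled leading term has a positive limit. -/
theorem logConcaveAt_of_pos {n ℓ : ℕ} {r : ℝ}
    (hr : growthRate n * growthRate (n + 2) = growthRate (n + 1) ^ 2 * r)
    (h : 0 < scaledCount (n + 1) ℓ ^ 2 - r ^ ℓ * (scaledCount n ℓ * scaledCount (n + 2) ℓ)) :
    LogConcaveAt ℓ (n + 1) := by
  have hpos : 0 < (growthRate (n + 1) ^ 2) ^ ℓ := by have := growthRate_pos (n + 1); positivity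
  have : (0 : ℝ) ≤ (logConcavityDefect ℓ (n + 1) : ℝ) := by
    rw [defect_eq, hr, mul_pow, mul_assoc, ← mul_sub]
    positivity
  exact_mod_cast this

theorem strictlyLogConvexAt_of_neg {n ℓ : ℕ} {r : ℝ}
    (hr : growthRate (n + 1) ^ 2 = growthRate n * growthRate (n + 2) * r)
    (h : r ^ ℓ * scaledCount (n + 1) ℓ ^ 2 - scaledCount n ℓ * scaledCount (n + 2) ℓ < 0) :
    StrictlyLogConvexAt ℓ (n + 1) := by
  have hpos : 0 < (growthRate n * growthRate (n + 2)) ^ ℓ := by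
    have := growthRate_pos n
    have := growthRate_pos (n + 2)
    positivity
  have : (logConcavityDefect ℓ (n + 1) : ℝ) < 0 := by
    rw [defect_eq, hr, mul_pow _ r, mul_assoc, ← mul_sub]
    exact mul_neg_of_pos_of_neg hpos h
  exact_mod_cast this

theorem eventually_logConcaveAt_three_mul (q : ℕ) :
    ∀ᶠ ℓ in atTop, LogConcaveAt ℓ (3 * q + 3) := by
  have hr : growthRate (3 * q + 2) * growthRate (3 * q + 2 + 2) =
      growthRate (3 * q + 2 + 1) ^ 2 * (8 / 9) := by
    rw [show 3 * q + 2 + 2 = 3 * q + 1 + 3 by ring, add_assoc (3 * q) 2 1, growthRate_add_three,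
      growthRate_add_three, growthRate_three_mul, growthRate_three_mul_add_one,
      growthRate_three_mul_add_two]
    ring
  have hlim := ((hasExpansion_scaledCount (3 * q + 2 + 1)).tendsto.pow 2).sub
    (tendsto_pow_eight_ninths.mul ((hasExpansion_scaledCount (3 * q + 2)).tendsto.mul
      (hasExpansion_scaledCount (3 * q + 2 + 2)).tendsto))
  have hpos : 0 < leadingCoeff (3 * q + 2 + 1) ^ 2 -
      0 * (leadingCoeff (3 * q + 2) * leadingCoeff (3 * q + 2 + 2)) := by
    rw [show 3 * q + 2 + 1 = 3 * (q + 1) by ring, leadingCoeff_three_mul, zero_mul, sub_zero]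
    exact pow_pos (tripleWeight_pos _) 2
  filter_upwards [hlim.eventually (lt_mem_nhds hpos)] with ℓ h
  exact logConcaveAt_of_pos hr h

theorem eventually_strictlyLogConvexAt_three_mul_add_one (q : ℕ) :
    ∀ᶠ ℓ in atTop, StrictlyLogConvexAt ℓ (3 * q + 1) := by
  have hr : growthRate (3 * q + 1) ^ 2 = growthRate (3 * q) * growthRate (3 * q + 2) * (8 / 9) := by
    rw [growthRate_three_mul, growthRate_three_mul_add_one, growthRate_three_mul_add_two]
    ring
  have hlim := (tendsto_pow_eight_ninths.mul
    ((hasExpansion_scaledCount (3 * q + 1)).tendsto.pow 2)).sub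
      ((hasExpansion_scaledCount (3 * q)).tendsto.mul
        (hasExpansion_scaledCount (3 * q + 2)).tendsto)
  have hneg : 0 * leadingCoeff (3 * q + 1) ^ 2 -
      leadingCoeff (3 * q) * leadingCoeff (3 * q + 2) < 0 := by
    rw [leadingCoeff_three_mul, leadingCoeff_three_mul_add_two]
    have := tripleWeight_pos q
    rw [zero_mul, zero_sub, neg_lt_zero]
    positivity
  filter_upwards [hlim.eventually (gt_mem_nhds hneg)] with ℓ h
  exact strictlyLogConvexAt_of_neg hr h

theorem growthRate_tie (q : ℕ) : growthRate (3 * q + 1) * growthRate (3 * q + 1 + 2) =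
    growthRate (3 * q + 1 + 1) ^ 2 := by
  rw [show 3 * q + 1 + 2 = 3 * q + 3 by ring, growthRate_add_three, growthRate_three_mul,
    growthRate_three_mul_add_one, show 3 * q + 1 + 1 = 3 * q + 2 by ring,
    growthRate_three_mul_add_two]
  ring

/-- In the residue class `2` the growth rates balance, and the sign of `6 - q` decides; it vanishes
at `3 * q + 2 = 20`. -/
theorem leadingCoeff_defect (q : ℕ) :
    leadingCoeff (3 * q + 1 + 1) ^ 2 - leadingCoeff (3 * q + 1) * leadingCoeff (3 * q + 1 + 2) =
      (6 - q) / 4 * (tripleWeight q * tripleWeight (q + 1)) := by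
  rw [show 3 * q + 1 + 2 = 3 * (q + 1) by ring, show 3 * q + 1 + 1 = 3 * q + 2 by ring,
    leadingCoeff_three_mul, leadingCoeff_three_mul_add_one, leadingCoeff_three_mul_add_two,
    tripleWeight_eq q]
  ring

theorem eventually_logConcaveAt_three_mul_add_two {q : ℕ} (hq : q < 6) :
    ∀ᶠ ℓ in atTop, LogConcaveAt ℓ (3 * q + 1 + 1) := by
  have hlim := ((hasExpansion_scaledCount (3 * q + 1 + 1)).tendsto.pow 2).sub
    ((hasExpansion_scaledCount (3 * q + 1)).tendsto.mul
      (hasExpansion_scaledCount (3 * q + 1 + 2)).tendsto)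
  have hq' : (0 : ℝ) < 6 - q := by
    have : (q : ℝ) < 6 := by exact_mod_cast hq
    linarith
  rw [leadingCoeff_defect] at hlim
  filter_upwards [hlim.eventually (lt_mem_nhds (by
    have := tripleWeight_pos q
    have := tripleWeight_pos (q + 1)
    positivity))] with ℓ h
  exact logConcaveAt_of_pos (r := 1) (by rw [growthRate_tie, mul_one]) (by simpa using h)

theorem eventually_strictlyLogConvexAt_three_mul_add_two {q : ℕ} (hq : 6 < q) :
    ∀ᶠ ℓ in atTop, StrictlyLogConvexAt ℓ (3 * q + 1 + 1) := by
  have hlim := ((hasExpansion_scaledCount (3 * q + 1 + 1)).tendsto.pow 2).sub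
    ((hasExpansion_scaledCount (3 * q + 1)).tendsto.mul
      (hasExpansion_scaledCount (3 * q + 1 + 2)).tendsto)
  have hneg : leadingCoeff (3 * q + 1 + 1) ^ 2 -
      leadingCoeff (3 * q + 1) * leadingCoeff (3 * q + 1 + 2) < 0 := by
    rw [leadingCoeff_defect]
    have h1 := tripleWeight_pos q
    have h2 := tripleWeight_pos (q + 1)
    have h3 : (6 : ℝ) - q < 0 := by
      have : (6 : ℝ) < q := by exact_mod_cast hq
      linarith
    exact mul_neg_of_neg_of_pos (by linarith) (mul_pos h1 h2)
  filter_upwards [hlim.eventually (gt_mem_nhds hneg)] with ℓ h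
  exact strictlyLogConvexAt_of_neg (r := 1) (by rw [growthRate_tie, mul_one]) (by simpa using h)

/-- At `n = 20` the leading coefficients balance as well, and the terms of order `(8/9) ^ ℓ`
decide. -/
theorem eventually_strictlyLogConvexAt_twenty : ∀ᶠ ℓ in atTop, StrictlyLogConvexAt ℓ 20 := by
  have h19 := hasExpansion_scaledCount 19
  have h20 := hasExpansion_scaledCount 20
  have h21 := hasExpansion_scaledCount 21
  have hexp := (h20.mul h20).add ((h19.mul h21).const_mul (-1))
  have hc : leadingCoeff 20 * leadingCoeff 20 + -1 * (leadingCoeff 19 * leadingCoeff 21) = 0 := by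
    have := leadingCoeff_defect 6
    norm_num at this
    linarith
  have hd : leadingCoeff 20 * secondCoeff 20 + secondCoeff 20 * leadingCoeff 20 +
      -1 * (leadingCoeff 19 * secondCoeff 21 + secondCoeff 19 * leadingCoeff 21) < 0 := by
    have e1 := leadingCoeff_three_mul_add_one 6
    have e2 := leadingCoeff_three_mul_add_two 6
    have e3 := leadingCoeff_three_mul 7
    have f1 := secondCoeff_three_mul_add_one 6
    have f2 := secondCoeff_three_mul_add_two 6
    have f3 := secondCoeff_three_mul 7
    have hw := tripleWeight_eq 6
    norm_num at e1 e2 e3 f1 f2 f3 hw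
    rw [e1, e2, e3, f1, f2, f3, hw]
    have := pow_pos (tripleWeight_pos 7) 2
    nlinarith
  rw [hc] at hexp
  filter_upwards [hexp.eventually_neg hd] with ℓ h
  exact strictlyLogConvexAt_of_neg (n := 19) (r := 1)
    (by rw [mul_one]; exact (growthRate_tie 6).symm) (by rw [one_pow]; linarith)

theorem mainTheorem1 (n : ℕ) (hn : 2 ≤ n) :
    (n ≡ 0 [MOD 3] → ∀ᶠ ℓ : ℕ in Filter.cofinite, LogConcaveAt ℓ n) ∧
    (n ≡ 1 [MOD 3] → ∀ᶠ ℓ : ℕ in Filter.cofinite, StrictlyLogConvexAt ℓ n) ∧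
    (n ≡ 2 [MOD 3] →
      (n < 20 → ∀ᶠ ℓ : ℕ in Filter.cofinite, LogConcaveAt ℓ n) ∧
      (20 ≤ n → ∀ᶠ ℓ : ℕ in Filter.cofinite, StrictlyLogConvexAt ℓ n)) := by
  rw [Nat.cofinite_eq_atTop]
  simp only [Nat.ModEq]
  refine ⟨fun h => ?_, fun h => ?_, fun h => ⟨fun hlt => ?_, fun hge => ?_⟩⟩
  · obtain ⟨q, rfl⟩ : ∃ q, n = 3 * q + 3 := ⟨n / 3 - 1, by omega⟩
    exact eventually_logConcaveAt_three_mul q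
  · obtain ⟨q, rfl⟩ : ∃ q, n = 3 * q + 1 := ⟨n / 3, by omega⟩
    exact eventually_strictlyLogConvexAt_three_mul_add_one q
  · obtain ⟨q, rfl⟩ : ∃ q, n = 3 * q + 1 + 1 := ⟨n / 3, by omega⟩
    exact eventually_logConcaveAt_three_mul_add_two (by omega)
  · rcases hge.eq_or_lt with rfl | hgt
    · exact eventually_strictlyLogConvexAt_twenty
    · obtain ⟨q, rfl⟩ : ∃ q, n = 3 * q + 1 + 1 := ⟨n / 3, by omega⟩
      exact eventually_strictlyLogConvexAt_three_mul_add_two (by omega)
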